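/- **Setting.** There are $I$ testing conditions; condition $i$ has a vector of stress levels $x_i\in\mathbb R^{s+1}$ and an inspection time $\tau_i$. Let $F_\theta(t,x)$, $\theta\in\mathbb R^d$, be a parametric family of cumulative distribution functions (in $t$) of the lifetime of a device under stress levels $x$ (in particular $d=2(s+1)$ is allowed), and write $F_i(\theta)=F_\theta(\tau_i,x_i)$ and $R_i=1-F_i$. Let $\theta_0$ be the true parameter, and let the lifetimes $T_{ik}$ ($1\le i\le I$, $k\ge 1$) be independent with $T_{ik}\sim F_{\theta_0}(\cdot,x_i)$. In the $n$-th experiment $K_i=K_i^{(n)}$ devices are tested under condition $i$, $K=K_1+\dots+K_I$, and only the numbers of failures $n_i=\#\{k\le K_i: T_{ik}\le\tau_i\}$ are observed; put $\hat p_i=n_i/K_i$. Assume that, as $n\to\infty$, $K\to\infty$ and $K_i/K\to w_i>0$ for every $i$. For $\gamma>0$ let $$D_\gamma(p,q)=q^{\gamma+1}+(1-q)^{\gamma+1}-\tfrac{\gamma+1}{\gamma}\bigl(p\,q^\gamma+(1-p)(1-q)^\gamma\bigr)+\tfrac1\gamma\bigl(p^{\gamma+1}+(1-p)^{\gamma+1}\bigr),$$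 and for $\gamma=0$ let $D_0(p,q)=p\log\frac pq+(1-p)\log\frac{1-p}{1-q}$. For $\gamma\ge 0$ and a parameter space $\Theta\subset\mathbb R^d$, a weighted minimum density power divergence estimator (WMDPDE) is a minimizer over $\theta\in\Theta$ of $\sum_{i=1}^I\frac{K_i}{K}D_\gamma(\hat p_i,F_i(\theta))$. **Regularity conditions.** 1. $\theta_0$ is an interior point of $\Theta$, and $0<F_i(\theta)<1$ for all $\theta\in\Theta$ and all $i$. 2. Every $F_i$ is continuously differentiable in a neighbourhood of $\theta_0$. 3. (Identifiability.) For every $\varepsilon>0$ there is $\delta>0$ such that every $\theta\in\Theta$ with $\|\theta-\theta_0\|\ge\varepsilon$ satisfies $|F_i(\theta)-F_i(\theta_0)|\ge\delta$ for some $i$. 4. The matrix $J_\gamma(\theta_0)$ below is nonsingular. **Proposition.** Let $\gamma\ge0$, assume 1–4, and let $\hat\theta_\gamma=\hat\theta_\gamma^{(n)}$ be random vectors that are WMDPDEs with probability tending to one. Then, as $n\to\infty$, $$\sqrt K\,(\hat\theta_\gamma-\theta_0)\ \xrightarrow{\ \mathcal L\ }\ \mathcal N\bigl(0,\;J_\gamma^{-1}(\theta_0)K_\gamma(\theta_0)J_\gamma^{-1}(\theta_0)\bigr),$$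 where $$J_\gamma(\theta)=\sum_{i=1}^I w_i\bigl(F_i(\theta)^{\gamma-1}+R_i(\theta)^{\gamma-1}\bigr)\frac{\partial F_i(\theta)}{\partial\theta}\frac{\partial F_i(\theta)}{\partial\theta^T},$$ $$K_\gamma(\theta)=\sum_{i=1}^I w_i\,F_i(\theta)R_i(\theta)\bigl(F_i(\theta)^{\gamma-1}+R_i(\theta)^{\gamma-1}\bigr)^2\frac{\partial F_i(\theta)}{\partial\theta}\frac{\partial F_i(\theta)}{\partial\theta^T}$$ (if $K_i/K$ is the same in all experiments, then $w_i=K_i/K$). -/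

import Mathlib

open MeasureTheory ProbabilityTheory Filter Topology

noncomputable section

namespace OneShot

/-- A parametric lifetime model: to a parameter `θ ∈ ℝ^d` and a vector of `s + 1` stress levels it
assigns the distribution of the lifetime of a device tested under these stress levels. -/
abbrev LifetimeModel (d s : ℕ) : Type :=
  EuclideanSpace ℝ (Fin d) → (Fin (s + 1) → ℝ) → Measure ℝ

/-- `F_θ(τ_i, x_i)`: the cdf of the lifetime under the `i`-th testing condition, at the `i`-th
inspection time, as a function of the parameter. -/
def failureProb {d s I : ℕ} (P : LifetimeModel d s) (x : Fin I → Fin (s + 1) → ℝ)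
    (τ : Fin I → ℝ) (i : Fin I) (θ : EuclideanSpace ℝ (Fin d)) : ℝ :=
  cdf (P θ (x i)) (τ i)

/-- The number `n_i` of the first `m` devices under a given condition whose lifetime does not
exceed the inspection time `t`. -/
def failureCount (T : ℕ → ℝ) (t : ℝ) (m : ℕ) : ℕ :=
  ((Finset.range m).filter (fun k => T k ≤ t)).card

/-- Density power divergence with tuning parameter `γ` between the Bernoulli probability vectors
`(p, 1 - p)` and `(q, 1 - q)`; for `γ = 0` it is the Kullback-Leibler divergence
(`0 * log 0 = 0`; used for `0 < q < 1` only). -/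
def dpd (γ p q : ℝ) : ℝ :=
  if γ = 0 then p * Real.log (p / q) + (1 - p) * Real.log ((1 - p) / (1 - q))
  else (q ^ (γ + 1) + (1 - q) ^ (γ + 1))
    - (γ + 1) / γ * (p * q ^ γ + (1 - p) * (1 - q) ^ γ)
    + 1 / γ * (p ^ (γ + 1) + (1 - p) ^ (γ + 1))

/-- The weighted density power divergence `∑ (K_i / K) D_γ(p̂_i, π_i(θ))`, with `K = ∑ K_i` and
`p̂_i = (n_i / K_i, 1 - n_i / K_i)`. -/
def wdpd {d I : ℕ} (γ : ℝ) (F : Fin I → EuclideanSpace ℝ (Fin d) → ℝ) (K n : Fin I → ℕ)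
    (θ : EuclideanSpace ℝ (Fin d)) : ℝ :=
  ∑ i, (K i : ℝ) / (∑ j, K j : ℕ) * dpd γ ((n i : ℝ) / K i) (F i θ)

/-- `θ` is a weighted minimum density power divergence estimate over the parameter space `Θ`. -/
def IsWMDPDE {d I : ℕ} (γ : ℝ) (Θ : Set (EuclideanSpace ℝ (Fin d)))
    (F : Fin I → EuclideanSpace ℝ (Fin d) → ℝ) (K n : Fin I → ℕ)
    (θ : EuclideanSpace ℝ (Fin d)) : Prop :=
  θ ∈ Θ ∧ IsMinOn (wdpd γ F K n) Θ θ

/-- `∂F/∂θ ∂F/∂θᵀ`. -/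
def gradOuter {d : ℕ} (f : EuclideanSpace ℝ (Fin d) → ℝ) (θ : EuclideanSpace ℝ (Fin d)) :
    Matrix (Fin d) (Fin d) ℝ :=
  Matrix.vecMulVec (gradient f θ).ofLp (gradient f θ).ofLp

/-- `J_γ(θ) = ∑ w_i (F^{γ-1} + R^{γ-1}) ∂F ∂Fᵀ`, where `R = 1 - F`. -/
def Jmat {d I : ℕ} (γ : ℝ) (w : Fin I → ℝ) (F : Fin I → EuclideanSpace ℝ (Fin d) → ℝ)
    (θ : EuclideanSpace ℝ (Fin d)) : Matrix (Fin d) (Fin d) ℝ :=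
  ∑ i, (w i * (F i θ ^ (γ - 1) + (1 - F i θ) ^ (γ - 1))) • gradOuter (F i) θ

/-- `K_γ(θ) = ∑ w_i F R (F^{γ-1} + R^{γ-1})² ∂F ∂Fᵀ`, where `R = 1 - F`. -/
def Kmat {d I : ℕ} (γ : ℝ) (w : Fin I → ℝ) (F : Fin I → EuclideanSpace ℝ (Fin d) → ℝ)
    (θ : EuclideanSpace ℝ (Fin d)) : Matrix (Fin d) (Fin d) ℝ :=
  ∑ i, (w i * (F i θ * (1 - F i θ) * (F i θ ^ (γ - 1) + (1 - F i θ) ^ (γ - 1)) ^ 2)) •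
    gradOuter (F i) θ

end OneShot

end

noncomputable section

namespace OneShot

/-! ### The density power divergence between Bernoulli distributions -/

/-! The argument is analytic until its last stage. In `q`, the divergence has derivative `(γ + 1) (q
- p) W(q)` with `W = dpdWeight γ`, and `W` is bounded below on `(0, 1)`. Hence the divergence
dominates a multiple of `(q - p)²`, and identifiability forces minimizers to be near `θ₀` once
weights and frequencies are near their limits.

There a minimizer solves `∑ (F_i(θ) - p_i) z_i W(F_i(θ)) ∇F_i(θ) = 0`. The factor `F_i(θ) - p_i` is
already small, so it suffices to expand it to first order and to freeze the vector beside it at its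
limit; no second derivatives are needed. This gives `J (θ - θ₀) ≈ ∑ (p_i - F_i(θ₀)) w_i W(F_i(θ₀))
∇F_i(θ₀)`, with an error `o(‖p - F(θ₀)‖)` uniform over minimizers
(`eventually_norm_sub_sub_sum_le_of_isMinOn`).

Probability enters through the standardized frequencies `√K_i (p̂_i - F_i(θ₀))`. Chebyshev's
inequality makes them bounded up to small probability, so the remainder multiplied by `√K` vanishes
in probability. Their fixed linear combination is asymptotically normal by a central limit theorem
for independent samples, and its covariance, a sum of rank-one matrices, is `J⁻¹ K J⁻¹`. Slutsky's
theorem concludes. -/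

/-- The weight `q ^ (γ - 1) + (1 - q) ^ (γ - 1)` in the derivative of the divergence. -/
def dpdWeight (γ q : ℝ) : ℝ := q ^ (γ - 1) + (1 - q) ^ (γ - 1)

lemma hasDerivAt_dpd {γ q : ℝ} (hγ : 0 ≤ γ) (p : ℝ) (hq : q ∈ Set.Ioo (0 : ℝ) 1) :
    HasDerivAt (dpd γ p) ((γ + 1) * ((q - p) * dpdWeight γ q)) q := by
  have hq0 : 0 < q := hq.1
  have hq1 : 0 < 1 - q := sub_pos.2 hq.2
  have hid : HasDerivAt (fun q : ℝ => 1 - q) (-1) q := by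
    simpa using (hasDerivAt_id q).const_sub 1
  rcases hγ.eq_or_lt with rfl | hγ
  · have hlog : ∀ (r : ℝ) (f : ℝ → ℝ) (f' : ℝ), HasDerivAt f f' q → 0 < f q →
        HasDerivAt (fun q => r * Real.log (r / f q)) (-(r * f' / f q)) q := by
      intro r f f' hf hpos
      -- For `r = 0` the chain rule through `log` is unavailable, but the factor `r` annihilates the
      -- function.
      rcases eq_or_ne r 0 with rfl | hr
      · simpa using hasDerivAt_const q (0 : ℝ)
      have h := (((hasDerivAt_const q r).fun_div hf hpos.ne').log
        (div_ne_zero hr hpos.ne')).const_mul r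
      refine h.congr_deriv ?_
      field_simp
      ring
    have h := (hlog p id 1 (hasDerivAt_id q) hq0).add (hlog (1 - p) _ _ hid hq1)
    have he : dpd 0 p = fun q => p * Real.log (p / id q)
        + (1 - p) * Real.log ((1 - p) / (1 - q)) := by
      ext q; simp [dpd]
    rw [he]
    refine h.congr_deriv ?_
    rw [dpdWeight, zero_sub, Real.rpow_neg_one, Real.rpow_neg_one]
    simp only [id]
    field_simp
    ring
  · have h1 (a : ℝ) := (Real.hasDerivAt_rpow_const (p := a) (Or.inl hq0.ne'))
    have h2 (a : ℝ) := hid.rpow_const (p := a) (Or.inl hq1.ne')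
    have h := (((h1 (γ + 1)).add (h2 (γ + 1))).sub
      ((((h1 γ).const_mul p).add ((h2 γ).const_mul (1 - p))).const_mul ((γ + 1) / γ))).add_const
        (1 / γ * (p ^ (γ + 1) + (1 - p) ^ (γ + 1)))
    have he : dpd γ p = fun q => (q ^ (γ + 1) + (1 - q) ^ (γ + 1))
        - (γ + 1) / γ * (p * q ^ γ + (1 - p) * (1 - q) ^ γ)
        + 1 / γ * (p ^ (γ + 1) + (1 - p) ^ (γ + 1)) := by
      ext q; simp [dpd, hγ.ne']
    rw [he]
    refine h.congr_deriv ?_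
    have e1 : q ^ γ = q ^ (γ - 1) * q := by
      rw [← Real.rpow_add_one hq0.ne']; congr 1; ring
    have e2 : (1 - q) ^ γ = (1 - q) ^ (γ - 1) * (1 - q) := by
      rw [← Real.rpow_add_one hq1.ne']; congr 1; ring
    rw [dpdWeight, add_sub_cancel_right, e1, e2]
    field_simp
    ring

lemma dpd_self {γ p : ℝ} (hγ : 0 ≤ γ) (hp : p ∈ Set.Ioo (0 : ℝ) 1) : dpd γ p p = 0 := by
  have hp1 : 0 < 1 - p := sub_pos.2 hp.2
  rcases hγ.eq_or_lt with rfl | hγ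
  · simp [dpd, div_self hp.1.ne', div_self hp1.ne']
  · rw [dpd, if_neg hγ.ne', Real.rpow_add_one hp.1.ne', Real.rpow_add_one hp1.ne']
    field_simp
    ring

lemma continuousAt_dpd_left {γ p q : ℝ} (hγ : 0 ≤ γ) (hp : p ∈ Set.Ioo (0 : ℝ) 1)
    (hq : q ∈ Set.Ioo (0 : ℝ) 1) : ContinuousAt (fun p => dpd γ p q) p := by
  have hp1 : 0 < 1 - p := sub_pos.2 hp.2
  have hq1 : 0 < 1 - q := sub_pos.2 hq.2
  rcases hγ.eq_or_lt with rfl | hγ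
  · simp only [dpd, if_true]
    have := hp.1
    have := hq.1
    refine ContinuousAt.add (ContinuousAt.mul (by fun_prop) (ContinuousAt.log (by fun_prop) ?_))
      (ContinuousAt.mul (by fun_prop) (ContinuousAt.log (by fun_prop) ?_)) <;> positivity
  · simp only [dpd, if_neg hγ.ne']
    have h1 : ContinuousAt (fun p : ℝ => p ^ (γ + 1)) p :=
      Real.continuousAt_rpow_const _ _ (Or.inl hp.1.ne')
    have h2 : ContinuousAt (fun p : ℝ => (1 - p) ^ (γ + 1)) p :=
      ContinuousAt.rpow_const (by fun_prop) (Or.inl hp1.ne')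
    fun_prop

/-- For `γ ≤ 1` the power `q ^ (γ - 1)` is at least 1; for `γ ≥ 1` the larger of `q` and `1 - q` is
at least `1 / 2`. -/
lemma exists_pos_le_dpdWeight (γ : ℝ) :
    ∃ c > 0, ∀ q ∈ Set.Ioo (0 : ℝ) 1, c ≤ dpdWeight γ q := by
  rcases le_total γ 1 with h | h
  · refine ⟨1, one_pos, fun q hq => ?_⟩
    have h1 := Real.one_le_rpow_of_pos_of_le_one_of_nonpos hq.1 hq.2.le (sub_nonpos.2 h)
    have h2 : 0 ≤ (1 - q) ^ (γ - 1) := Real.rpow_nonneg (sub_nonneg.2 hq.2.le) _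
    rw [dpdWeight]; linarith
  · refine ⟨(1 / 2 : ℝ) ^ (γ - 1), by positivity, fun q hq => ?_⟩
    have h1 : 0 ≤ q ^ (γ - 1) := Real.rpow_nonneg hq.1.le _
    have h2 : 0 ≤ (1 - q) ^ (γ - 1) := Real.rpow_nonneg (sub_nonneg.2 hq.2.le) _
    rw [dpdWeight]
    rcases le_total (1 / 2) q with hh | hh
    · have := Real.rpow_le_rpow (by norm_num) hh (sub_nonneg.2 h)
      linarith
    · have := Real.rpow_le_rpow (by norm_num) (show 1 / 2 ≤ 1 - q by linarith) (sub_nonneg.2 h)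
      linarith

lemma continuousAt_dpdWeight (γ : ℝ) {q : ℝ} (hq : q ∈ Set.Ioo (0 : ℝ) 1) :
    ContinuousAt (dpdWeight γ) q := by
  have h1 : ContinuousAt (fun q : ℝ => q ^ (γ - 1)) q :=
    Real.continuousAt_rpow_const _ _ (Or.inl hq.1.ne')
  have h2 : ContinuousAt (fun q : ℝ => (1 - q) ^ (γ - 1)) q :=
    ContinuousAt.rpow_const (by fun_prop) (Or.inl (sub_pos.2 hq.2).ne')
  exact h1.add h2

/-- The divergence dominates the squared distance. -/
lemma exists_pos_mul_sq_le_dpd {γ : ℝ} (hγ : 0 ≤ γ) :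
    ∃ c > 0, ∀ p ∈ Set.Ioo (0 : ℝ) 1, ∀ q ∈ Set.Ioo (0 : ℝ) 1,
      c * (q - p) ^ 2 ≤ dpd γ p q := by
  obtain ⟨c, hc, hcw⟩ := exists_pos_le_dpdWeight γ
  refine ⟨c / 2, by positivity, fun p hp q hq => ?_⟩
  -- `g` vanishes at `p`, and its derivative is `q - p` times a nonnegative factor, so `p` minimizes
  -- it on `(0, 1)`.
  set g : ℝ → ℝ := fun q => dpd γ p q - c / 2 * (q - p) ^ 2
  have hg : ∀ y ∈ Set.Ioo (0 : ℝ) 1,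
      HasDerivAt g ((y - p) * ((γ + 1) * dpdWeight γ y - c)) y := by
    intro y hy
    have h1 : HasDerivAt (fun q : ℝ => c / 2 * (q - p) ^ 2) (c * (y - p)) y := by
      refine ((((hasDerivAt_id y).sub_const p).fun_pow 2).const_mul (c / 2)).congr_deriv ?_
      simp only [id]; push_cast; ring
    exact ((hasDerivAt_dpd hγ p hy).sub h1).congr_deriv (by ring)
  have hpos : ∀ y ∈ Set.Ioo (0 : ℝ) 1, 0 ≤ (γ + 1) * dpdWeight γ y - c := by
    intro y hy
    nlinarith [hcw y hy]
  have hgp : g p = 0 := by simp [g, dpd_self hγ hp]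
  suffices 0 ≤ g q by simpa [g, sub_nonneg] using this
  rw [← hgp]
  rcases le_total p q with hpq | hpq
  · have hsub : Set.Icc p q ⊆ Set.Ioo (0 : ℝ) 1 := Set.Icc_subset_Ioo hp.1 hq.2
    refine monotoneOn_of_hasDerivWithinAt_nonneg (convex_Icc p q)
      (fun y hy => (hg y (hsub hy)).continuousAt.continuousWithinAt)
      (fun y hy => (hg y (hsub (interior_subset hy))).hasDerivWithinAt) (fun y hy => ?_)
      (Set.left_mem_Icc.2 hpq) (Set.right_mem_Icc.2 hpq) hpq
    exact mul_nonneg (sub_nonneg.2 (interior_subset hy).1) (hpos y (hsub (interior_subset hy)))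
  · have hsub : Set.Icc q p ⊆ Set.Ioo (0 : ℝ) 1 := Set.Icc_subset_Ioo hq.1 hp.2
    refine antitoneOn_of_hasDerivWithinAt_nonpos (convex_Icc q p)
      (fun y hy => (hg y (hsub hy)).continuousAt.continuousWithinAt)
      (fun y hy => (hg y (hsub (interior_subset hy))).hasDerivWithinAt) (fun y hy => ?_)
      (Set.left_mem_Icc.2 hpq) (Set.right_mem_Icc.2 hpq) hpq
    exact mul_nonpos_of_nonpos_of_nonneg (sub_nonpos.2 (interior_subset hy).2)
      (hpos y (hsub (interior_subset hy)))

/-! ### Minimizers of the weighted divergence -/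

open scoped RealInnerProductSpace

variable {d I : ℕ}

/-- The weighted divergence as a function of arbitrary weights and frequencies. -/
def divSum (γ : ℝ) (F : Fin I → EuclideanSpace ℝ (Fin d) → ℝ) (z : (Fin I → ℝ) × (Fin I → ℝ))
    (θ : EuclideanSpace ℝ (Fin d)) : ℝ :=
  ∑ i, z.1 i * dpd γ (z.2 i) (F i θ)

section Minimizers

variable {γ : ℝ} {Θ : Set (EuclideanSpace ℝ (Fin d))} {θ₀ : EuclideanSpace ℝ (Fin d)}
  {F : Fin I → EuclideanSpace ℝ (Fin d) → ℝ} {w : Fin I → ℝ}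

/-- Minimizers are close to the true parameter when the weights and the frequencies are close to
their limits. -/
lemma eventually_norm_sub_lt_of_isMinOn (hγ : 0 ≤ γ) (hθ₀ : θ₀ ∈ Θ) (hw : ∀ i, 0 < w i)
    (hF01 : ∀ i, ∀ θ ∈ Θ, F i θ ∈ Set.Ioo (0 : ℝ) 1)
    (hident : ∀ ε > 0, ∃ δ > 0, ∀ θ ∈ Θ, ε ≤ ‖θ - θ₀‖ → ∃ i, δ ≤ |F i θ - F i θ₀|)
    {ε : ℝ} (hε : 0 < ε) :
    ∀ᶠ z in 𝓝 (w, fun i => F i θ₀), ∀ θ ∈ Θ, IsMinOn (divSum γ F z) Θ θ → ‖θ - θ₀‖ < ε := by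
  obtain ⟨δ, hδ, hsep⟩ := hident ε hε
  obtain ⟨c, hc, hcd⟩ := exists_pos_mul_sq_le_dpd hγ
  have hz1 (i : Fin I) : Tendsto (fun z : (Fin I → ℝ) × (Fin I → ℝ) => z.1 i)
      (𝓝 (w, fun i => F i θ₀)) (𝓝 (w i)) :=
    (Continuous.tendsto (by fun_prop : Continuous fun z : (Fin I → ℝ) × (Fin I → ℝ) => z.1 i) _)
  have hz2 (i : Fin I) : Tendsto (fun z : (Fin I → ℝ) × (Fin I → ℝ) => z.2 i)
      (𝓝 (w, fun i => F i θ₀)) (𝓝 (F i θ₀)) :=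
    (Continuous.tendsto (by fun_prop : Continuous fun z : (Fin I → ℝ) × (Fin I → ℝ) => z.2 i) _)
  have hzero : Tendsto (fun z => divSum γ F z θ₀) (𝓝 (w, fun i => F i θ₀)) (𝓝 0) := by
    have h : ∀ i ∈ Finset.univ, Tendsto (fun z : (Fin I → ℝ) × (Fin I → ℝ) =>
        z.1 i * dpd γ (z.2 i) (F i θ₀)) (𝓝 (w, fun i => F i θ₀))
        (𝓝 (w i * dpd γ (F i θ₀) (F i θ₀))) := fun i _ =>
      (hz1 i).mul ((continuousAt_dpd_left hγ (hF01 i _ hθ₀) (hF01 i _ hθ₀)).tendsto.comp (hz2 i))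
    simpa [divSum, dpd_self hγ (hF01 _ _ hθ₀)] using tendsto_finsetSum _ h
  have hA : ∀ᶠ z in 𝓝 (w, fun i => F i θ₀), ∀ i, w i / 2 < z.1 i :=
    eventually_all.2 fun i => (hz1 i).eventually_const_lt (half_lt_self (hw i))
  have hB : ∀ᶠ z in 𝓝 (w, fun i => F i θ₀), ∀ i, z.2 i ∈ Set.Ioo (0 : ℝ) 1 :=
    eventually_all.2 fun i => (hz2 i).eventually (isOpen_Ioo.mem_nhds (hF01 i _ hθ₀))
  have hC : ∀ᶠ z in 𝓝 (w, fun i => F i θ₀), ∀ i, |z.2 i - F i θ₀| < δ / 2 :=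
    eventually_all.2 fun i => by
      simpa [Real.dist_eq] using Metric.tendsto_nhds.1 (hz2 i) (δ / 2) (half_pos hδ)
  -- The right-hand side is what a single badly fitted condition contributes at a parameter far from
  -- `θ₀`; all other summands are nonnegative.
  have hD : ∀ᶠ z in 𝓝 (w, fun i => F i θ₀), ∀ i,
      divSum γ F z θ₀ < w i / 2 * (c * (δ / 2) ^ 2) :=
    eventually_all.2 fun i => hzero.eventually_lt_const (by have := hw i; positivity)
  filter_upwards [hA, hB, hC, hD] with z hzA hzB hzC hzD θ hθ hmin
  by_contra! hfar
  obtain ⟨i, hi⟩ := hsep θ hθ hfar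
  have h1 : divSum γ F z θ ≤ divSum γ F z θ₀ := hmin hθ₀
  have hnn (j : Fin I) : 0 ≤ z.1 j * dpd γ (z.2 j) (F j θ) := by
    have h := hcd _ (hzB j) _ (hF01 j θ hθ)
    have := hw j
    exact mul_nonneg (by linarith [hzA j]) (le_trans (by positivity) h)
  have h2 : z.1 i * dpd γ (z.2 i) (F i θ) ≤ divSum γ F z θ :=
    Finset.single_le_sum (f := fun j => z.1 j * dpd γ (z.2 j) (F j θ)) (fun j _ => hnn j)
      (Finset.mem_univ i)
  have h3 : δ / 2 ≤ |F i θ - z.2 i| := by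
    have := abs_sub_le (F i θ) (z.2 i) (F i θ₀)
    linarith [hzC i]
  have h4 : (δ / 2) ^ 2 ≤ (F i θ - z.2 i) ^ 2 := by
    rw [← sq_abs (F i θ - z.2 i)]
    gcongr
  have h5 : c * (δ / 2) ^ 2 ≤ dpd γ (z.2 i) (F i θ) :=
    (mul_le_mul_of_nonneg_left h4 hc.le).trans (hcd _ (hzB i) _ (hF01 i θ hθ))
  have h6 : w i / 2 * (c * (δ / 2) ^ 2) ≤ z.1 i * dpd γ (z.2 i) (F i θ) :=
    mul_le_mul (hzA i).le h5 (by positivity) (by linarith [hw i, hzA i])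
  linarith [hzD i]

/-- The estimating equation satisfied by an interior minimizer. -/
lemma sum_smul_gradient_eq_zero (hγ : 0 ≤ γ) {z : (Fin I → ℝ) × (Fin I → ℝ)}
    {θ : EuclideanSpace ℝ (Fin d)} (hΘ : Θ ∈ 𝓝 θ)
    (hF01 : ∀ i, F i θ ∈ Set.Ioo (0 : ℝ) 1) (hF : ∀ i, DifferentiableAt ℝ (F i) θ)
    (hmin : IsMinOn (divSum γ F z) Θ θ) :
    ∑ i, (F i θ - z.2 i) • (z.1 i * dpdWeight γ (F i θ)) • gradient (F i) θ = 0 := by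
  have hd : HasFDerivAt (divSum γ F z) (∑ i, z.1 i •
      ((γ + 1) * ((F i θ - z.2 i) * dpdWeight γ (F i θ))) • fderiv ℝ (F i) θ) θ :=
    HasFDerivAt.fun_sum fun i _ =>
      ((hasDerivAt_dpd hγ (z.2 i) (hF01 i)).comp_hasFDerivAt θ (hF i).hasFDerivAt).const_mul _
  have h0 := (hmin.isLocalMin hΘ).hasFDerivAt_eq_zero hd
  -- The Riesz isomorphism turns the vanishing derivative into an equation between gradients.
  have h1 := congrArg (InnerProductSpace.toDual ℝ (EuclideanSpace ℝ (Fin d))).symm h0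
  rw [map_zero, map_sum] at h1
  have h2 : (γ + 1) • ∑ i, (F i θ - z.2 i) • (z.1 i * dpdWeight γ (F i θ)) • gradient (F i) θ
      = 0 := by
    rw [← h1, Finset.smul_sum]
    refine Finset.sum_congr rfl fun i _ => ?_
    simp only [map_smulₛₗ, gradient, smul_smul, RCLike.conj_to_real, map_mul, map_add, map_sub,
      map_one]
    congr 1
    ring
  exact (smul_eq_zero.1 h2).resolve_left (by positivity)

/-- Continuity of the gradient at `θ₀` enters here: it allows the coefficient vectors of the
estimating equation to be frozen at their limits. -/
lemma tendsto_weight_smul_gradient (hF01 : ∀ i, F i θ₀ ∈ Set.Ioo (0 : ℝ) 1)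
    (hF : ∀ i, ContDiffAt ℝ 1 (F i) θ₀) (π : Fin I → ℝ) (i : Fin I) :
    Tendsto (fun y : ((Fin I → ℝ) × (Fin I → ℝ)) × EuclideanSpace ℝ (Fin d) =>
      (y.1.1 i * dpdWeight γ (F i y.2)) • gradient (F i) y.2) (𝓝 ((w, π), θ₀))
      (𝓝 ((w i * dpdWeight γ (F i θ₀)) • gradient (F i) θ₀)) := by
  have h2 : Tendsto (fun y : ((Fin I → ℝ) × (Fin I → ℝ)) × EuclideanSpace ℝ (Fin d) => y.2)
      (𝓝 ((w, π), θ₀)) (𝓝 θ₀) := continuous_snd.tendsto _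
  have h1 : Tendsto (fun y : ((Fin I → ℝ) × (Fin I → ℝ)) × EuclideanSpace ℝ (Fin d) => y.1.1 i)
      (𝓝 ((w, π), θ₀)) (𝓝 (w i)) :=
    Continuous.tendsto (f := fun y : ((Fin I → ℝ) × (Fin I → ℝ)) × EuclideanSpace ℝ (Fin d) =>
      y.1.1 i) (by fun_prop) _
  have hg : ContinuousAt (gradient (F i)) θ₀ :=
    (InnerProductSpace.toDual ℝ (EuclideanSpace ℝ (Fin d))).symm.continuous.continuousAt.comp
      ((hF i).fderiv_right (m := 0) le_rfl).continuousAt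
  exact (h1.mul ((ContinuousAt.comp (continuousAt_dpdWeight γ (hF01 i))
    (hF i).continuousAt).tendsto.comp h2)).smul (hg.tendsto.comp h2)

/-- Absorption: substituting the bound on `y` gives `x ≤ t x + t (U + 1) e`, and `t ≤ 1 / 2` moves
`t x` to the left. In use, `x` is the linearization error, `y = ‖θ - θ₀‖` and `e` is the deviation
of the frequencies. -/
lemma le_mul_of_le_mul_add {x y e t U ε : ℝ} (ht : 0 ≤ t) (hx : 0 ≤ x) (he : 0 ≤ e)
    (ht2 : t ≤ 1 / 2) (htε : 2 * t * (U + 1) ≤ ε) (hy : y ≤ x + U * e)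
    (hxy : x ≤ t * (y + e)) : x ≤ ε * e := by
  have h5 : x ≤ t * (x + (U + 1) * e) :=
    hxy.trans (mul_le_mul_of_nonneg_left (by linarith) ht)
  have h6 : t * x ≤ 1 / 2 * x := mul_le_mul_of_nonneg_right ht2 hx
  have h7 : 2 * t * (U + 1) * e ≤ ε * e := mul_le_mul_of_nonneg_right htε he
  linarith

/-- A perturbation bound for linear systems. -/
lemma norm_sub_sum_smul_le {V : Type*} [NormedAddCommGroup V] [InnerProductSpace ℝ V]
    {g c c' : Fin I → V} {A : V →L[ℝ] V} (hA : ∀ h, A (∑ i, ⟪g i, h⟫ • c i) = h)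
    {h : V} {e f : Fin I → ℝ} {η : ℝ} (hη : 0 ≤ η) (hη1 : η ≤ 1)
    (hc : ∀ i, ‖c' i - c i‖ ≤ η) (hf : ∀ i, ‖f i - ⟪g i, h⟫‖ ≤ η * ‖h‖)
    (heq : ∑ i, (f i - e i) • c' i = 0) :
    ‖h - ∑ i, e i • A (c i)‖ ≤ ‖A‖ * (η * ∑ i, (‖g i‖ + ‖c i‖ + 2)) * (‖h‖ + ‖e‖) := by
  have he (i : Fin I) : |e i| ≤ ‖e‖ := norm_le_pi_norm e i
  -- Writing `h` as `A (∑ ⟪g i, h⟫ • c i)` and subtracting the perturbed equation `heq` leaves only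
  -- products with a small factor, `c i - c' i` or `f i - ⟪g i, h⟫`.
  have hmain : h - ∑ i, e i • A (c i) =
      A (∑ i, ((⟪g i, h⟫ - e i) • (c i - c' i) - (f i - ⟪g i, h⟫) • c' i)) := by
    have h1 : ∑ i, ((⟪g i, h⟫ - e i) • (c i - c' i) - (f i - ⟪g i, h⟫) • c' i)
        = ∑ i, ⟪g i, h⟫ • c i - ∑ i, e i • c i - ∑ i, (f i - e i) • c' i := by
      rw [← Finset.sum_sub_distrib, ← Finset.sum_sub_distrib]
      exact Finset.sum_congr rfl fun i _ => by module
    rw [h1, heq, sub_zero, map_sub, hA h, map_sum]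
    simp
  have hbound : ‖∑ i, ((⟪g i, h⟫ - e i) • (c i - c' i) - (f i - ⟪g i, h⟫) • c' i)‖
      ≤ (η * ∑ i, (‖g i‖ + ‖c i‖ + 2)) * (‖h‖ + ‖e‖) := by
    rw [Finset.mul_sum, Finset.sum_mul]
    refine norm_sum_le_of_le _ fun i _ => ?_
    have h1 : ‖c i - c' i‖ ≤ η := by rw [norm_sub_rev]; exact hc i
    have h2 : ‖c' i‖ ≤ ‖c i‖ + 1 := by
      have := norm_le_norm_add_norm_sub' (c' i) (c i)
      linarith [hc i]
    have h3 : ‖⟪g i, h⟫ - e i‖ ≤ ‖g i‖ * ‖h‖ + ‖e‖ :=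
      (norm_sub_le _ _).trans (add_le_add (norm_inner_le_norm _ _) (he i))
    calc _ ≤ ‖⟪g i, h⟫ - e i‖ * ‖c i - c' i‖ + ‖f i - ⟪g i, h⟫‖ * ‖c' i‖ := by
          rw [← norm_smul, ← norm_smul]; exact norm_sub_le _ _
      _ ≤ (‖g i‖ * ‖h‖ + ‖e‖) * η + η * ‖h‖ * (‖c i‖ + 1) := by
          gcongr
          exact hf i
      _ ≤ _ := by
          have : 0 ≤ η * ‖h‖ := by positivity
          have : 0 ≤ η * ‖e‖ * (‖g i‖ + ‖c i‖ + 1) := by positivity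
          linarith
  rw [hmain, mul_assoc]
  exact (A.le_opNorm _).trans (mul_le_mul_of_nonneg_left hbound (norm_nonneg _))

/-- Linearization of the estimating equation around the true parameter. -/
lemma eventually_norm_sub_sub_sum_le (hF01 : ∀ i, F i θ₀ ∈ Set.Ioo (0 : ℝ) 1)
    (hF : ∀ i, ContDiffAt ℝ 1 (F i) θ₀)
    (A : EuclideanSpace ℝ (Fin d) →L[ℝ] EuclideanSpace ℝ (Fin d))
    (hA : ∀ h, A (∑ i, ⟪gradient (F i) θ₀, h⟫ •
      (w i * dpdWeight γ (F i θ₀)) • gradient (F i) θ₀) = h)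
    {ε : ℝ} (hε : 0 < ε) :
    ∀ᶠ y in 𝓝 (((w, fun i => F i θ₀), θ₀) :
        ((Fin I → ℝ) × (Fin I → ℝ)) × EuclideanSpace ℝ (Fin d)),
      ∑ i, (F i y.2 - y.1.2 i) • (y.1.1 i * dpdWeight γ (F i y.2)) • gradient (F i) y.2 = 0 →
      ‖(y.2 - θ₀) - ∑ i, (y.1.2 i - F i θ₀) •
        A ((w i * dpdWeight γ (F i θ₀)) • gradient (F i) θ₀)‖
        ≤ ε * ‖y.1.2 - fun i => F i θ₀‖ := by
  set g : Fin I → EuclideanSpace ℝ (Fin d) := fun i => gradient (F i) θ₀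
  set c : Fin I → EuclideanSpace ℝ (Fin d) := fun i => (w i * dpdWeight γ (F i θ₀)) • g i
  set M : ℝ := ∑ i, (‖g i‖ + ‖c i‖ + 2)
  set U : ℝ := ∑ i, ‖A (c i)‖
  have hM : 0 ≤ M := Finset.sum_nonneg fun i _ => by positivity
  have hU : 0 ≤ U := Finset.sum_nonneg fun i _ => by positivity
  -- With `t = ‖A‖ * (η * M)`, the last two bounds are the hypotheses of the absorption lemma; both
  -- left-hand sides vanish as `η → 0`.
  obtain ⟨η, hη, hη1, hη2, hη3⟩ : ∃ η : ℝ, 0 < η ∧ η ≤ 1 ∧ ‖A‖ * (η * M) ≤ 1 / 2 ∧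
      2 * (‖A‖ * (η * M)) * (U + 1) ≤ ε := by
    have h1 : Tendsto (fun η : ℝ => ‖A‖ * (η * M)) (𝓝[>] 0) (𝓝 0) := by
      have : Continuous fun η : ℝ => ‖A‖ * (η * M) := by fun_prop
      simpa using (this.tendsto 0).mono_left nhdsWithin_le_nhds
    have h2 : Tendsto (fun η : ℝ => 2 * (‖A‖ * (η * M)) * (U + 1)) (𝓝[>] 0) (𝓝 0) := by
      simpa using (h1.const_mul 2).mul_const (U + 1)
    have h3 : ∀ᶠ η : ℝ in 𝓝[>] 0, η ≤ 1 :=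
      nhdsWithin_le_nhds (Iic_mem_nhds one_pos)
    obtain ⟨η, h⟩ := (eventually_mem_nhdsWithin.and (h3.and
      ((h1.eventually_le_const (by norm_num : (0 : ℝ) < 1 / 2)).and
        (h2.eventually_le_const hε)))).exists
    exact ⟨η, h⟩
  have hc : ∀ᶠ y in 𝓝 (((w, fun i => F i θ₀), θ₀) :
      ((Fin I → ℝ) × (Fin I → ℝ)) × EuclideanSpace ℝ (Fin d)), ∀ i,
      ‖(y.1.1 i * dpdWeight γ (F i y.2)) • gradient (F i) y.2 - c i‖ < η :=
    eventually_all.2 fun i => by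
      simpa [dist_eq_norm] using
        Metric.tendsto_nhds.1 (tendsto_weight_smul_gradient hF01 hF _ i) η hη
  have hr : ∀ᶠ y in 𝓝 (((w, fun i => F i θ₀), θ₀) :
      ((Fin I → ℝ) × (Fin I → ℝ)) × EuclideanSpace ℝ (Fin d)), ∀ i,
      ‖F i y.2 - F i θ₀ - ⟪g i, y.2 - θ₀⟫‖ ≤ η * ‖y.2 - θ₀‖ :=
    eventually_all.2 fun i => by
      have h := (hasGradientAt_iff_isLittleO.1
        ((hF i).differentiableAt one_ne_zero).hasGradientAt).def hη
      exact (continuous_snd.tendsto (((w, fun i => F i θ₀), θ₀) :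
        ((Fin I → ℝ) × (Fin I → ℝ)) × EuclideanSpace ℝ (Fin d))).eventually h
  filter_upwards [hc, hr] with y hyc hyr hy
  have hy' : ∑ i, ((F i y.2 - F i θ₀) - (y.1.2 - fun i => F i θ₀) i) •
      (y.1.1 i * dpdWeight γ (F i y.2)) • gradient (F i) y.2 = 0 := by
    rw [← hy]
    exact Finset.sum_congr rfl fun i _ => by rw [Pi.sub_apply, sub_sub_sub_cancel_right]
  have hfin := norm_sub_sum_smul_le hA hη.le hη1 (fun i => (hyc i).le) hyr hy'
  have hsum : ‖∑ i, (y.1.2 - fun i => F i θ₀) i • A (c i)‖ ≤ U * ‖y.1.2 - fun i => F i θ₀‖ := by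
    rw [Finset.sum_mul]
    refine norm_sum_le_of_le _ fun i _ => ?_
    rw [norm_smul, mul_comm]
    exact mul_le_mul_of_nonneg_left (norm_le_pi_norm _ i) (norm_nonneg _)
  refine le_mul_of_le_mul_add (mul_nonneg (norm_nonneg _) (mul_nonneg hη.le hM)) (norm_nonneg _)
    (norm_nonneg _) hη2 hη3 ?_ hfin
  exact (norm_le_norm_add_norm_sub' (y.2 - θ₀) _).trans
    ((add_le_add hsum le_rfl).trans_eq (add_comm _ _))

/-- Asymptotic linearity of the minimizers in the frequencies. -/
lemma eventually_norm_sub_sub_sum_le_of_isMinOn (hγ : 0 ≤ γ) (hΘ : Θ ∈ 𝓝 θ₀) (hw : ∀ i, 0 < w i)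
    (hF01 : ∀ i, ∀ θ ∈ Θ, F i θ ∈ Set.Ioo (0 : ℝ) 1)
    (hF : ∀ i, ContDiffAt ℝ 1 (F i) θ₀)
    (hident : ∀ ε > 0, ∃ δ > 0, ∀ θ ∈ Θ, ε ≤ ‖θ - θ₀‖ → ∃ i, δ ≤ |F i θ - F i θ₀|)
    (A : EuclideanSpace ℝ (Fin d) →L[ℝ] EuclideanSpace ℝ (Fin d))
    (hA : ∀ h, A (∑ i, ⟪gradient (F i) θ₀, h⟫ •
      (w i * dpdWeight γ (F i θ₀)) • gradient (F i) θ₀) = h)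
    {ε : ℝ} (hε : 0 < ε) :
    ∀ᶠ z in 𝓝 (w, fun i => F i θ₀), ∀ θ ∈ Θ, IsMinOn (divSum γ F z) Θ θ →
      ‖(θ - θ₀) - ∑ i, (z.2 i - F i θ₀) •
        A ((w i * dpdWeight γ (F i θ₀)) • gradient (F i) θ₀)‖
        ≤ ε * ‖z.2 - fun i => F i θ₀‖ := by
  have hθ₀ := mem_of_mem_nhds hΘ
  have h1 := eventually_norm_sub_sub_sum_le (γ := γ) (fun i => hF01 i θ₀ hθ₀) hF A hA hε
  rw [nhds_prod_eq, eventually_prod_iff] at h1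
  obtain ⟨pa, hpa, pb, hpb, hab⟩ := h1
  have hdiff : ∀ᶠ θ in 𝓝 θ₀, ∀ i, DifferentiableAt ℝ (F i) θ :=
    eventually_all.2 fun i => ((hF i).eventually (by simp)).mono
      fun θ h => h.differentiableAt one_ne_zero
  -- Within distance `ρ` of `θ₀` the linearization holds and points are interior to `Θ`; consistency
  -- puts every minimizer there.
  obtain ⟨ρ, hρ, hball⟩ := Metric.eventually_nhds_iff.1
    (hpb.and (hdiff.and (eventually_mem_nhds_iff.2 hΘ)))
  filter_upwards [hpa, eventually_norm_sub_lt_of_isMinOn hγ hθ₀ hw hF01 hident hρ]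
    with z hz hclose θ hθ hmin
  obtain ⟨hb, hd, hn⟩ := hball (by rw [dist_eq_norm]; exact hclose θ hθ hmin)
  exact hab hz hb (sum_smul_gradient_eq_zero hγ hn (fun i => hF01 i θ hθ) hd hmin)

/-- Asymptotic linearity of the minimizers, uniformly over standardized frequencies in a bounded
set. -/
lemma eventually_norm_sqrt_smul_sub_le (hγ : 0 ≤ γ) (hΘ : Θ ∈ 𝓝 θ₀) (hw : ∀ i, 0 < w i)
    (hF01 : ∀ i, ∀ θ ∈ Θ, F i θ ∈ Set.Ioo (0 : ℝ) 1)
    (hF : ∀ i, ContDiffAt ℝ 1 (F i) θ₀)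
    (hident : ∀ ε > 0, ∃ δ > 0, ∀ θ ∈ Θ, ε ≤ ‖θ - θ₀‖ → ∃ i, δ ≤ |F i θ - F i θ₀|)
    (A : EuclideanSpace ℝ (Fin d) →L[ℝ] EuclideanSpace ℝ (Fin d))
    (hA : ∀ h, A (∑ i, ⟪gradient (F i) θ₀, h⟫ •
      (w i * dpdWeight γ (F i θ₀)) • gradient (F i) θ₀) = h)
    (K : ℕ → Fin I → ℕ) (hK : Tendsto (fun n => ∑ i, K n i) atTop atTop)
    (hKw : ∀ i, Tendsto (fun n => (K n i : ℝ) / (∑ j, K n j : ℕ)) atTop (𝓝 (w i)))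
    (M : ℝ) {η : ℝ} (hη : 0 < η) :
    ∀ᶠ n in atTop, ∀ p : Fin I → ℝ, (∀ i, |√(K n i) * (p i - F i θ₀)| ≤ M) →
      ∀ θ ∈ Θ, IsMinOn (divSum γ F (fun i => (K n i : ℝ) / (∑ j, K n j : ℕ), p)) Θ θ →
      ‖√(∑ i, K n i : ℕ) • (θ - θ₀) - ∑ i, (√(K n i) * (p i - F i θ₀)) •
        ((√(w i))⁻¹ • A ((w i * dpdWeight γ (F i θ₀)) • gradient (F i) θ₀))‖ ≤ η := by
  set u : Fin I → EuclideanSpace ℝ (Fin d) :=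
    fun i => A ((w i * dpdWeight γ (F i θ₀)) • gradient (F i) θ₀)
  set r : ℕ → Fin I → ℝ := fun n i => (K n i : ℝ) / (∑ j, K n j : ℕ)
  set M' : ℝ := max M 0
  have hM' : 0 ≤ M' := le_max_right _ _
  -- A bound for `√K ‖p - F(θ₀)‖`: eventually `√(K / K_i) ≤ (√(w i))⁻¹ + 1`.
  set B : ℝ := ∑ i, ((√(w i))⁻¹ + 1) * M'
  have hB : 0 ≤ B := Finset.sum_nonneg fun i _ => by positivity
  obtain ⟨ε, hε, hεη⟩ : ∃ ε > 0, ε * B ≤ η / 2 := by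
    refine ⟨η / 2 / (B + 1), by positivity, ?_⟩
    rw [div_mul_eq_mul_div, div_le_iff₀ (by positivity)]
    nlinarith
  have hlin := eventually_norm_sub_sub_sum_le_of_isMinOn hγ hΘ hw hF01 hF hident A hA hε
  rw [nhds_prod_eq, eventually_prod_iff] at hlin
  obtain ⟨pa, hpa, pb, hpb, hab⟩ := hlin
  obtain ⟨ρ, hρ, hball⟩ := Metric.eventually_nhds_iff.1 hpb
  have hr : Tendsto r atTop (𝓝 w) := tendsto_pi_nhds.2 hKw
  have hKr : Tendsto (fun n => ((∑ i, K n i : ℕ) : ℝ)) atTop atTop :=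
    tendsto_natCast_atTop_atTop.comp hK
  have hs (i : Fin I) : Tendsto (fun n => (√(r n i))⁻¹) atTop (𝓝 (√(w i))⁻¹) :=
    ((Real.continuous_sqrt.tendsto _).comp (hKw i)).inv₀ (Real.sqrt_pos.2 (hw i)).ne'
  have hdiff : Tendsto (fun n => ∑ i, |(√(r n i))⁻¹ - (√(w i))⁻¹| * M' * ‖u i‖) atTop (𝓝 0) := by
    have : ∀ i ∈ Finset.univ, Tendsto (fun n => |(√(r n i))⁻¹ - (√(w i))⁻¹| * M' * ‖u i‖)
        atTop (𝓝 (|(√(w i))⁻¹ - (√(w i))⁻¹| * M' * ‖u i‖)) := fun i _ =>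
      ((((hs i).sub_const _).abs).mul_const M').mul_const ‖u i‖
    simpa using tendsto_finsetSum _ this
  have hsmall : ∀ᶠ n in atTop, ∀ i, ((√(w i))⁻¹ + 1) * M' / √(∑ i, K n i : ℕ) < ρ :=
    eventually_all.2 fun i =>
      ((Real.tendsto_sqrt_atTop.comp hKr).const_div_atTop _).eventually_lt_const hρ
  have hs1 : ∀ᶠ n in atTop, ∀ i, (√(r n i))⁻¹ ≤ (√(w i))⁻¹ + 1 :=
    eventually_all.2 fun i => (hs i).eventually_le_const (by linarith)
  have hr0 : ∀ᶠ n in atTop, ∀ i, 0 < r n i :=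
    eventually_all.2 fun i => (hKw i).eventually_const_lt (hw i)
  filter_upwards [hr.eventually hpa, hsmall, hs1, hr0, hKr.eventually_gt_atTop 0,
    hdiff.eventually_le_const (half_pos hη)] with n h1 h2 h3 h4 h5 h6 p hp θ hθ hmin
  set S : ℝ := √(∑ i, K n i : ℕ)
  have hS : 0 < S := Real.sqrt_pos.2 h5
  have hSe (i : Fin I) : S * (p i - F i θ₀) = (√(r n i))⁻¹ * (√(K n i) * (p i - F i θ₀)) := by
    have hk : 0 < √(K n i : ℝ) := by
      have := h4 i
      rw [Real.sqrt_pos]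
      by_contra! hneg
      exact this.not_ge (div_nonpos_of_nonpos_of_nonneg hneg h5.le)
    simp only [r]
    rw [Real.sqrt_div (Nat.cast_nonneg _), inv_div]
    change _ = S / _ * _
    field_simp
  have hpM (i : Fin I) : |√(K n i) * (p i - F i θ₀)| ≤ M' := (hp i).trans (le_max_left _ _)
  have hSp (i : Fin I) : S * |p i - F i θ₀| ≤ ((√(w i))⁻¹ + 1) * M' := by
    rw [← abs_of_pos hS, ← abs_mul, hSe, abs_mul, abs_of_nonneg (by positivity)]
    exact mul_le_mul (h3 i) (hpM i) (abs_nonneg _) (by positivity)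
  -- Bounded standardized deviations force `p` close to `F(θ₀)`, since `√K → ∞`.
  have hpb' : pb p := by
    refine hball ?_
    rw [dist_pi_lt_iff hρ]
    intro i
    refine lt_of_le_of_lt ?_ (h2 i)
    rw [Real.dist_eq, le_div_iff₀ hS, mul_comm]
    exact hSp i
  have hfin := hab h1 hpb' θ hθ hmin
  have hnorm : S * ‖p - fun i => F i θ₀‖ ≤ B := by
    rw [← le_div_iff₀' hS, pi_norm_le_iff_of_nonneg (by positivity)]
    intro i
    rw [le_div_iff₀' hS]
    exact (hSp i).trans (Finset.single_le_sum (f := fun i => ((√(w i))⁻¹ + 1) * M')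
      (fun j _ => by positivity) (Finset.mem_univ i))
  -- Two errors: the linearization error multiplied by `√K`, and the replacement of the ratios `K_i
  -- / K` by their limits.
  have hdec : S • (θ - θ₀) - ∑ i, (√(K n i) * (p i - F i θ₀)) • ((√(w i))⁻¹ • u i)
      = S • ((θ - θ₀) - ∑ i, (p i - F i θ₀) • u i)
        + ∑ i, (((√(r n i))⁻¹ - (√(w i))⁻¹) * (√(K n i) * (p i - F i θ₀))) • u i := by
    have : S • ∑ i, (p i - F i θ₀) • u i
        = ∑ i, ((√(r n i))⁻¹ * (√(K n i) * (p i - F i θ₀))) • u i := by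
      rw [Finset.smul_sum]
      exact Finset.sum_congr rfl fun i _ => by rw [smul_smul, hSe]
    rw [smul_sub S (θ - θ₀), this, sub_add, ← Finset.sum_sub_distrib]
    congr 1
    exact Finset.sum_congr rfl fun i _ => by module
  rw [hdec]
  refine (norm_add_le _ _).trans ?_
  have hfirst : ‖S • ((θ - θ₀) - ∑ i, (p i - F i θ₀) • u i)‖ ≤ η / 2 := by
    rw [norm_smul, Real.norm_of_nonneg hS.le]
    calc _ ≤ S * (ε * ‖p - fun i => F i θ₀‖) := mul_le_mul_of_nonneg_left hfin hS.le
      _ = ε * (S * ‖p - fun i => F i θ₀‖) := by ring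
      _ ≤ ε * B := mul_le_mul_of_nonneg_left hnorm hε.le
      _ ≤ _ := hεη
  have hsecond : ‖∑ i, (((√(r n i))⁻¹ - (√(w i))⁻¹) * (√(K n i) * (p i - F i θ₀))) • u i‖
      ≤ η / 2 := by
    refine (norm_sum_le_of_le _ fun i _ => ?_).trans h6
    rw [norm_smul, norm_mul]
    exact mul_le_mul_of_nonneg_right
      (mul_le_mul_of_nonneg_left (hpM i) (norm_nonneg _)) (norm_nonneg _)
  linarith

end Minimizers

/-! ### A central limit theorem for several samples -/

section Sampling

variable {Ω : Type*} [MeasurableSpace Ω] {μ : Measure Ω}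

lemma posSemidef_sum_vecMulVec_self (b : Fin I → EuclideanSpace ℝ (Fin d)) :
    (∑ i, Matrix.vecMulVec (b i).ofLp (b i).ofLp).PosSemidef :=
  Matrix.posSemidef_sum _ fun i _ => by
    simpa using Matrix.posSemidef_vecMulVec_self_star (b i).ofLp

lemma dotProduct_sum_vecMulVec_mulVec (b : Fin I → EuclideanSpace ℝ (Fin d))
    (t : EuclideanSpace ℝ (Fin d)) :
    t.ofLp ⬝ᵥ (∑ i, Matrix.vecMulVec (b i).ofLp (b i).ofLp).mulVec t.ofLp = ∑ i, ⟪b i, t⟫ ^ 2 := by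
  rw [Matrix.sum_mulVec, dotProduct_sum]
  refine Finset.sum_congr rfl fun i _ => ?_
  rw [Matrix.vecMulVec_mulVec]
  simp only [dotProduct_smul, EuclideanSpace.inner_eq_star_dotProduct, star_trivial, sq]
  rw [dotProduct_comm (b i).ofLp]
  rfl

lemma charFun_map_mul_smul {X : Ω → ℝ} (hX : AEMeasurable X μ) (a : ℝ)
    (b t : EuclideanSpace ℝ (Fin d)) :
    charFun (μ.map fun ω => (a * X ω) • b) t = charFun (μ.map X) (a * ⟪b, t⟫) := by
  rw [charFun_apply, charFun_apply_real, integral_map (by fun_prop) (by fun_prop),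
    integral_map hX (by fun_prop)]
  refine integral_congr_ae (ae_of_all _ fun ω => ?_)
  simp only [real_inner_smul_left]
  congr 1
  push_cast
  ring

variable [IsProbabilityMeasure μ]

/-- **Central limit theorem** for linear combinations of normalized sums of several independent
samples of independent, identically distributed, standardized random variables. -/
theorem tendstoInDistribution_sum_inv_sqrt_mul_sum_smul {X : Fin I → ℕ → Ω → ℝ}
    (hindep : iIndepFun (fun ik : Fin I × ℕ => X ik.1 ik.2) μ)
    (hident : ∀ i k, IdentDistrib (X i k) (X i 0) μ μ)
    (h0 : ∀ i, μ[X i 0] = 0) (h1 : ∀ i, μ[X i 0 ^ 2] = 1)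
    {K : ℕ → Fin I → ℕ} (hK : ∀ i, Tendsto (fun n => K n i) atTop atTop)
    (b : Fin I → EuclideanSpace ℝ (Fin d)) :
    TendstoInDistribution
      (fun n ω => ∑ i, ((√(K n i))⁻¹ * ∑ k ∈ Finset.range (K n i), X i k ω) • b i) atTop
      (id : EuclideanSpace ℝ (Fin d) → EuclideanSpace ℝ (Fin d)) (fun _ => μ)
      (multivariateGaussian 0 (∑ i, Matrix.vecMulVec (b i).ofLp (b i).ofLp)) where
  forall_aemeasurable n := by
    have := fun i k => (hident i k).aemeasurable_fst
    fun_prop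
  tendsto := by
    have mX := fun i k => (hident i k).aemeasurable_fst
    refine ProbabilityMeasure.tendsto_iff_tendsto_charFun.2 fun t => ?_
    have hlim : charFun (multivariateGaussian 0 (∑ i, Matrix.vecMulVec (b i).ofLp (b i).ofLp)) t
        = ∏ i, Complex.exp (-((⟪b i, t⟫ : ℝ) : ℂ) ^ 2 / 2) := by
      rw [charFun_multivariateGaussian (posSemidef_sum_vecMulVec_self b),
        dotProduct_sum_vecMulVec_mulVec, ← Complex.exp_sum]
      simp [neg_div, Finset.sum_div]
    have hpre (n : ℕ) : charFun (μ.map fun ω =>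
        ∑ i, ((√(K n i))⁻¹ * ∑ k ∈ Finset.range (K n i), X i k ω) • b i) t
        = ∏ i, charFun (μ.map (X i 0)) ((√(K n i))⁻¹ * ⟪b i, t⟫) ^ K n i := by
      -- All observations are flattened into one independent family, so that the characteristic
      -- function of the total is a product over single observations.
      have he : (fun ω => ∑ i, ((√(K n i))⁻¹ * ∑ k ∈ Finset.range (K n i), X i k ω) • b i)
          = fun ω => ∑ x : (Σ i, Fin (K n i)), ((√(K n x.1))⁻¹ * X x.1 x.2 ω) • b x.1 := by
        ext1 ω
        rw [Fintype.sum_sigma]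
        refine Finset.sum_congr rfl fun i _ => ?_
        rw [Finset.sum_range, Finset.mul_sum, Finset.sum_smul]
      have hinj : Function.Injective
          (fun x : (Σ i, Fin (K n i)) => ((x.1, (x.2 : ℕ)) : Fin I × ℕ)) := by
        rintro ⟨i, k⟩ ⟨j, l⟩ h
        simp only [Prod.mk.injEq] at h
        obtain ⟨rfl, h⟩ := h
        simp [Fin.ext h]
      have hind : iIndepFun (fun x : (Σ i, Fin (K n i)) => fun ω =>
          ((√(K n x.1))⁻¹ * X x.1 x.2 ω) • b x.1) μ :=
        (hindep.precomp hinj).comp (fun x y => ((√(K n x.1))⁻¹ * y) • b x.1) (by fun_prop)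
      rw [he, hind.charFun_map_fun_sum_eq_prod (fun x => by have := mX x.1 x.2; fun_prop),
        Finset.prod_apply, Fintype.prod_sigma]
      refine Finset.prod_congr rfl fun i _ => ?_
      simp_rw [charFun_map_mul_smul (mX _ _), (hident _ _).map_eq]
      simp
    simp only [ProbabilityMeasure.coe_mk, Measure.map_id, hlim, hpre]
    exact tendsto_finsetProd _ fun i _ =>
      (tendsto_charFun_inv_sqrt_mul_pow (mX i 0) (h0 i) (h1 i) _).comp (hK i)

/-- **Chebyshev's inequality** for normalized sums. -/
lemma measure_le_abs_inv_sqrt_mul_sum_le {X : ℕ → Ω → ℝ} (hindep : iIndepFun X μ)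
    (hident : ∀ k, IdentDistrib (X k) (X 0) μ μ) (hX : MemLp (X 0) 2 μ)
    (h0 : μ[X 0] = 0) (h1 : μ[X 0 ^ 2] = 1) (m : ℕ) {c : ℝ} (hc : 0 < c) :
    μ {ω | c ≤ |(√m)⁻¹ * ∑ k ∈ Finset.range m, X k ω|} ≤ ENNReal.ofReal (1 / c ^ 2) := by
  have hL (k : ℕ) : MemLp (X k) 2 μ := (hident k).memLp_iff.2 hX
  have hv (k : ℕ) : variance (X k) μ = 1 := by
    rw [(hident k).variance_eq, variance_of_integral_eq_zero (hident 0).aemeasurable_fst h0]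
    exact h1
  have hY : MemLp (fun ω => (√m)⁻¹ * ∑ k ∈ Finset.range m, X k ω) 2 μ :=
    (memLp_finsetSum _ fun k _ => hL k).const_mul _
  have hE : μ[fun ω => (√m)⁻¹ * ∑ k ∈ Finset.range m, X k ω] = 0 := by
    rw [integral_const_mul, integral_finsetSum _ fun k _ => (hL k).integrable one_le_two]
    simp [fun k => (hident k).integral_eq, h0]
  have hV : variance (fun ω => (√m)⁻¹ * ∑ k ∈ Finset.range m, X k ω) μ ≤ 1 := by
    have h2 := IndepFun.variance_sum (s := Finset.range m) (fun k _ => hL k)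
      fun i _ j _ hij => hindep.indepFun hij
    have h3 : (fun ω => ∑ k ∈ Finset.range m, X k ω) = ∑ k ∈ Finset.range m, X k := by
      ext; simp
    rw [variance_const_mul, h3, h2]
    simp only [hv, Finset.sum_const, Finset.card_range, nsmul_eq_mul, mul_one, inv_pow,
      Real.sq_sqrt (Nat.cast_nonneg m)]
    -- The variance is 1 except for `m = 0`, where it is 0.
    exact inv_mul_le_one
  have h := meas_ge_le_variance_div_sq hY hc
  rw [hE] at h
  simp only [sub_zero] at h
  refine h.trans (ENNReal.ofReal_le_ofReal ?_)
  gcongr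

/-! ### Standardized failure indicators -/

/-- The standardized indicator of the half-line `(-∞, t]` for the success probability `q`. -/
def stdIndicator (t q y : ℝ) : ℝ := ((Set.Iic t).indicator 1 y - q) / √(q * (1 - q))

@[fun_prop]
lemma measurable_stdIndicator (t q : ℝ) : Measurable (stdIndicator t q) :=
  ((measurable_one.indicator measurableSet_Iic).sub_const q).div_const _

lemma memLp_stdIndicator (t q : ℝ) (ν : Measure ℝ) [IsProbabilityMeasure ν] :
    MemLp (stdIndicator t q) 2 ν := by
  have h : MemLp ((Set.Iic t).indicator (1 : ℝ → ℝ)) 2 ν :=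
    (memLp_const (1 : ℝ)).indicator measurableSet_Iic
  have h2 := (h.sub (memLp_const q)).const_mul (√(q * (1 - q)))⁻¹
  refine h2.ae_eq (ae_of_all _ fun y => ?_)
  simp [stdIndicator, div_eq_inv_mul]

lemma integral_indicator_Iic (t : ℝ) (ν : Measure ℝ) [IsProbabilityMeasure ν] :
    ∫ y, (Set.Iic t).indicator (1 : ℝ → ℝ) y ∂ν = cdf ν t := by
  rw [integral_indicator_one measurableSet_Iic, cdf_eq_real]

lemma integrable_indicator_Iic (t : ℝ) (ν : Measure ℝ) [IsProbabilityMeasure ν] :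
    Integrable ((Set.Iic t).indicator (1 : ℝ → ℝ)) ν :=
  (integrable_const (1 : ℝ)).indicator measurableSet_Iic

lemma integral_stdIndicator {t q : ℝ} (ν : Measure ℝ) [IsProbabilityMeasure ν]
    (hq : cdf ν t = q) : ∫ y, stdIndicator t q y ∂ν = 0 := by
  simp only [stdIndicator]
  rw [integral_div, integral_sub (integrable_indicator_Iic t ν) (integrable_const _),
    integral_indicator_Iic, hq]
  simp

lemma integral_stdIndicator_sq {t q : ℝ} (ν : Measure ℝ) [IsProbabilityMeasure ν]
    (hq : cdf ν t = q) (hq01 : q ∈ Set.Ioo (0 : ℝ) 1) : ∫ y, stdIndicator t q y ^ 2 ∂ν = 1 := by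
  have hpos : 0 < q * (1 - q) := mul_pos hq01.1 (sub_pos.2 hq01.2)
  -- An indicator equals its own square, so the squared expression is affine in it.
  have he (y : ℝ) : stdIndicator t q y ^ 2
      = ((1 - 2 * q) * (Set.Iic t).indicator 1 y + q ^ 2) / (q * (1 - q)) := by
    rw [stdIndicator, div_pow, Real.sq_sqrt hpos.le]
    congr 1
    by_cases hy : y ∈ Set.Iic t
    · simp [hy]; ring
    · simp [hy]
  simp_rw [he]
  rw [integral_div, integral_add ((integrable_indicator_Iic t ν).const_mul _) (integrable_const _),
    integral_const_mul, integral_indicator_Iic, hq]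
  simp only [integral_const, probReal_univ, smul_eq_mul, one_mul]
  rw [div_eq_one_iff_eq hpos.ne']
  ring

lemma sqrt_mul_failureCount_div_sub (T : ℕ → ℝ) (t : ℝ) {q : ℝ} (hq : q ∈ Set.Ioo (0 : ℝ) 1)
    (m : ℕ) : √m * ((failureCount T t m : ℝ) / m - q) =
      √(q * (1 - q)) * ((√m)⁻¹ * ∑ k ∈ Finset.range m, stdIndicator t q (T k)) := by
  have hpos : 0 < √(q * (1 - q)) := Real.sqrt_pos.2 (mul_pos hq.1 (sub_pos.2 hq.2))
  have hs : ∑ k ∈ Finset.range m, stdIndicator t q (T k)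
      = ((failureCount T t m : ℝ) - m * q) / √(q * (1 - q)) := by
    simp only [stdIndicator]
    rw [← Finset.sum_div, Finset.sum_sub_distrib, failureCount, Finset.card_filter]
    simp [Set.indicator_apply]
  rw [hs]
  -- For an empty sample both sides are 0, because `√0 = 0` and the sum is empty.
  rcases Nat.eq_zero_or_pos m with rfl | hm
  · simp
  have hm' : 0 < √(m : ℝ) := Real.sqrt_pos.2 (by exact_mod_cast hm)
  have hm2 : (m : ℝ) = √(m : ℝ) ^ 2 := (Real.sq_sqrt (Nat.cast_nonneg m)).symm
  generalize √(m : ℝ) = r at hm' hm2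
  rw [hm2]
  field_simp

end Sampling

/-! ### The asymptotic covariance matrix -/

section Covariance

variable {γ : ℝ} {θ : EuclideanSpace ℝ (Fin d)}
  {F : Fin I → EuclideanSpace ℝ (Fin d) → ℝ} {w : Fin I → ℝ}

lemma isSymm_Jmat : (Jmat γ w F θ).IsSymm := by
  ext i j
  simp only [Jmat, gradOuter, Matrix.transpose_apply, Matrix.sum_apply, Matrix.smul_apply,
    Matrix.vecMulVec_apply]
  exact Finset.sum_congr rfl fun k _ => by rw [mul_comm (gradient (F k) θ j)]

/-- The linear part of the estimating equation is exactly the operator of `J`; this supplies the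
hypothesis `hA` of the linearization lemmas. -/
lemma toEuclideanCLM_inv_Jmat_sum (hJ : IsUnit (Jmat γ w F θ).det) (h : EuclideanSpace ℝ (Fin d)) :
    Matrix.toEuclideanCLM (𝕜 := ℝ) (Jmat γ w F θ)⁻¹ (∑ i, ⟪gradient (F i) θ, h⟫ •
      (w i * dpdWeight γ (F i θ)) • gradient (F i) θ) = h := by
  have h1 : ∑ i, ⟪gradient (F i) θ, h⟫ • (w i * dpdWeight γ (F i θ)) • gradient (F i) θ
      = Matrix.toEuclideanCLM (𝕜 := ℝ) (Jmat γ w F θ) h := by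
    apply (WithLp.ofLp_injective 2)
    rw [Matrix.ofLp_toEuclideanCLM, Jmat, Matrix.sum_mulVec, WithLp.ofLp_sum]
    refine Finset.sum_congr rfl fun i _ => ?_
    rw [gradOuter, Matrix.smul_mulVec, Matrix.vecMulVec_mulVec, WithLp.ofLp_smul,
      WithLp.ofLp_smul, smul_comm, EuclideanSpace.inner_eq_star_dotProduct, star_trivial,
      dotProduct_comm]
    ext j
    simp [dpdWeight, mul_comm]
  rw [h1, ← mul_apply_eq_comp, ← map_mul, Matrix.nonsing_inv_mul _ hJ, map_one,
    one_apply_eq_self]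

/-- As `J` is symmetric, conjugation by `J⁻¹` turns each `∂F ∂Fᵀ` into the outer square of `J⁻¹ ∂F`,
and its scalar coefficient is a square. The result has the form of the covariance in the central
limit theorem. -/
lemma inv_Jmat_mul_Kmat_mul_inv_Jmat (hw : ∀ i, 0 < w i)
    (hF01 : ∀ i, F i θ ∈ Set.Ioo (0 : ℝ) 1) :
    (Jmat γ w F θ)⁻¹ * Kmat γ w F θ * (Jmat γ w F θ)⁻¹ =
      ∑ i, Matrix.vecMulVec
        (√(F i θ * (1 - F i θ)) • (√(w i))⁻¹ • Matrix.toEuclideanCLM (𝕜 := ℝ) (Jmat γ w F θ)⁻¹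
          ((w i * dpdWeight γ (F i θ)) • gradient (F i) θ)).ofLp
        (√(F i θ * (1 - F i θ)) • (√(w i))⁻¹ • Matrix.toEuclideanCLM (𝕜 := ℝ) (Jmat γ w F θ)⁻¹
          ((w i * dpdWeight γ (F i θ)) • gradient (F i) θ)).ofLp := by
  have hsymm : ((Jmat γ w F θ)⁻¹).transpose = (Jmat γ w F θ)⁻¹ := by
    rw [Matrix.transpose_nonsing_inv, isSymm_Jmat.eq]
  rw [Kmat, Matrix.mul_sum, Matrix.sum_mul]
  refine Finset.sum_congr rfl fun i _ => ?_
  have hv : 0 ≤ F i θ * (1 - F i θ) := (mul_pos (hF01 i).1 (sub_pos.2 (hF01 i).2)).le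
  have hcoef : w i * (F i θ * (1 - F i θ) * dpdWeight γ (F i θ) ^ 2) =
      (√(F i θ * (1 - F i θ)) * ((√(w i))⁻¹ * (w i * dpdWeight γ (F i θ)))) ^ 2 := by
    rw [mul_pow, mul_pow, Real.sq_sqrt hv, inv_pow, Real.sq_sqrt (hw i).le]
    field_simp [(hw i).ne']
  rw [gradOuter, Matrix.mul_smul, Matrix.smul_mul, Matrix.mul_vecMulVec, Matrix.vecMulVec_mul,
    ← Matrix.mulVec_transpose, hsymm]
  change (w i * (F i θ * (1 - F i θ) * dpdWeight γ (F i θ) ^ 2)) • _ = _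
  rw [hcoef, map_smul, smul_smul, smul_smul, WithLp.ofLp_smul, Matrix.ofLp_toEuclideanCLM,
    Matrix.smul_vecMulVec, Matrix.vecMulVec_smul, smul_smul, ← sq, mul_assoc]

end Covariance

/-! ### Convergence in probability of remainder terms -/

section Remainder

variable {Ω : Type*} [MeasurableSpace Ω] {μ : Measure Ω}

/-- Convergence in probability to zero of variables that are eventually small outside of the union
of a set of vanishing probability and finitely many sets of small probability. -/
lemma tendstoInMeasure_zero_of_forall_norm_le {E : Type*} [NormedAddCommGroup E]
    {Y : ℕ → Ω → E} {G : Fin I → ℕ → Ω → ℝ} {S : ℕ → Set Ω}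
    (hS : Tendsto (fun n => μ (S n)) atTop (𝓝 0))
    (hG : ∀ i n, ∀ c > 0, μ {ω | c ≤ |G i n ω|} ≤ ENNReal.ofReal (1 / c ^ 2))
    (hY : ∀ M : ℝ, ∀ η > 0, ∀ᶠ n in atTop, ∀ ω, ω ∉ S n → (∀ i, |G i n ω| ≤ M) → ‖Y n ω‖ ≤ η) :
    TendstoInMeasure μ Y atTop 0 := by
  rw [tendstoInMeasure_iff_norm]
  intro η hη
  rw [ENNReal.tendsto_nhds_zero]
  intro ρ hρ
  have hρ2 : 0 < ρ / 2 := ENNReal.half_pos hρ.ne'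
  -- `M` is chosen so that the union bound over the `I` Chebyshev estimates costs at most `ρ / 2`.
  obtain ⟨M, hM, hM0⟩ : ∃ M : ℝ, (I : ENNReal) * ENNReal.ofReal (1 / M ^ 2) ≤ ρ / 2 ∧ 0 < M := by
    have h1 : Tendsto (fun M : ℝ => (I : ENNReal) * ENNReal.ofReal (1 / M ^ 2)) atTop (𝓝 0) := by
      have h2 : Tendsto (fun M : ℝ => 1 / M ^ 2) atTop (𝓝 0) :=
        (tendsto_pow_atTop two_ne_zero).const_div_atTop 1
      have h3 := ENNReal.tendsto_ofReal h2
      rw [ENNReal.ofReal_zero] at h3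
      simpa using ENNReal.Tendsto.const_mul (a := (I : ENNReal)) h3 (Or.inr (by simp))
    exact ((ENNReal.tendsto_nhds_zero.1 h1 _ hρ2).and (eventually_gt_atTop 0)).exists
  filter_upwards [ENNReal.tendsto_nhds_zero.1 hS _ hρ2, hY M (η / 2) (half_pos hη)] with n h1 h2
  have hsub : {ω | η ≤ ‖Y n ω - (0 : Ω → E) ω‖} ⊆ S n ∪ ⋃ i, {ω | M ≤ |G i n ω|} := by
    intro ω hω
    by_contra hcon
    simp only [Set.mem_union, Set.mem_iUnion, Set.mem_ofPred_eq, not_or, not_exists, not_le] at hcon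
    have h3 := h2 ω hcon.1 fun i => (hcon.2 i).le
    simp only [Pi.zero_apply, sub_zero, Set.mem_ofPred_eq] at hω
    linarith
  -- Only monotonicity and subadditivity are used, so the sets need not be measurable.
  calc _ ≤ μ (S n) + μ (⋃ i, {ω | M ≤ |G i n ω|}) := (measure_mono hsub).trans (measure_union_le _ _)
    _ ≤ ρ / 2 + ∑ i, μ {ω | M ≤ |G i n ω|} := add_le_add h1 (measure_iUnion_fintype_le _ _)
    _ ≤ ρ / 2 + ∑ _i : Fin I, ENNReal.ofReal (1 / M ^ 2) := by
        gcongr with i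
        exact hG i n M hM0
    _ ≤ ρ / 2 + ρ / 2 := by
        gcongr
        simpa using hM
    _ = ρ := ENNReal.add_halves ρ

end Remainder

end OneShot

end

/-! ### Asymptotic normality of the estimators -/

theorem mainTheorem3
    {d s I : ℕ}
    -- the lifetime model, the parameter space, the true parameter and the tuning parameter
    (P : OneShot.LifetimeModel d s) [hP : ∀ θ y, IsProbabilityMeasure (P θ y)]
    (Θ : Set (EuclideanSpace ℝ (Fin d))) (θ₀ : EuclideanSpace ℝ (Fin d))
    (γ : ℝ) (hγ : 0 ≤ γ)
    -- stress levels and inspection times of the testing conditions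
    (x : Fin I → Fin (s + 1) → ℝ) (τ : Fin I → ℝ)
    -- independent lifetimes, following the model with parameter `θ₀`
    {Ω : Type*} [MeasurableSpace Ω] (μ : Measure Ω) [IsProbabilityMeasure μ]
    (T : Fin I → ℕ → Ω → ℝ)
    (hTlaw : ∀ i k, HasLaw (T i k) (P θ₀ (x i)) μ)
    (hTindep : iIndepFun (fun (ik : Fin I × ℕ) => T ik.1 ik.2) μ)
    -- group sizes: `K → ∞` and `K_i / K → w_i > 0`
    (K : ℕ → Fin I → ℕ) (w : Fin I → ℝ)
    (hK : Tendsto (fun n => ∑ i, K n i) atTop atTop)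
    (hw : ∀ i, 0 < w i)
    (hKw : ∀ i, Tendsto (fun n => (K n i : ℝ) / (∑ j, K n j : ℕ)) atTop (𝓝 (w i)))
    -- regularity conditions
    (hΘ : Θ ∈ 𝓝 θ₀)
    (hF01 : ∀ i, ∀ θ ∈ Θ, OneShot.failureProb P x τ i θ ∈ Set.Ioo (0 : ℝ) 1)
    (hFdiff : ∀ i, ContDiffAt ℝ 1 (OneShot.failureProb P x τ i) θ₀)
    (hident : ∀ ε > 0, ∃ δ > 0, ∀ θ ∈ Θ, ε ≤ ‖θ - θ₀‖ →
      ∃ i, δ ≤ |OneShot.failureProb P x τ i θ - OneShot.failureProb P x τ i θ₀|)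
    (hJ : IsUnit (OneShot.Jmat γ w (OneShot.failureProb P x τ) θ₀).det)
    -- the estimators: minimizers with probability tending to one
    (θhat : ℕ → Ω → EuclideanSpace ℝ (Fin d))
    (hmeas : ∀ n, AEMeasurable (θhat n) μ)
    (hmin : Tendsto (fun n => μ {ω | ¬ OneShot.IsWMDPDE γ Θ (OneShot.failureProb P x τ) (K n)
      (fun i => OneShot.failureCount (fun k => T i k ω) (τ i) (K n i)) (θhat n ω)})
      atTop (𝓝 0)) :
    TendstoInDistribution
      (fun n ω => Real.sqrt (∑ i, K n i : ℕ) • (θhat n ω - θ₀)) atTop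
      (id : EuclideanSpace ℝ (Fin d) → EuclideanSpace ℝ (Fin d)) (fun _ => μ)
      (multivariateGaussian 0
        ((OneShot.Jmat γ w (OneShot.failureProb P x τ) θ₀)⁻¹
          * OneShot.Kmat γ w (OneShot.failureProb P x τ) θ₀
          * (OneShot.Jmat γ w (OneShot.failureProb P x τ) θ₀)⁻¹)) := by
  
  set F := OneShot.failureProb P x τ
  have hθ₀ : θ₀ ∈ Θ := mem_of_mem_nhds hΘ
  have h01 (i : Fin I) : F i θ₀ ∈ Set.Ioo (0 : ℝ) 1 := hF01 i θ₀ hθ₀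
  set A := Matrix.toEuclideanCLM (𝕜 := ℝ) (OneShot.Jmat γ w F θ₀)⁻¹
  set c : Fin I → EuclideanSpace ℝ (Fin d) := fun i =>
    (√(w i))⁻¹ • A ((w i * OneShot.dpdWeight γ (F i θ₀)) • gradient (F i) θ₀)
  set X : Fin I → ℕ → Ω → ℝ := fun i k ω =>
    OneShot.stdIndicator (τ i) (F i θ₀) (T i k ω)
  set v : Fin I → ℝ := fun i => √(F i θ₀ * (1 - F i θ₀))
  set G : Fin I → ℕ → Ω → ℝ := fun i n ω => √(K n i) * ((OneShot.failureCount
    (fun k => T i k ω) (τ i) (K n i) : ℝ) / K n i - F i θ₀)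
  have hGX (i : Fin I) (n : ℕ) (ω : Ω) :
      G i n ω = v i * ((√(K n i))⁻¹ * ∑ k ∈ Finset.range (K n i), X i k ω) :=
    OneShot.sqrt_mul_failureCount_div_sub _ _ (h01 i) _
  have hXindep : iIndepFun (fun ik : Fin I × ℕ => X ik.1 ik.2) μ :=
    hTindep.comp (fun ik => OneShot.stdIndicator (τ ik.1) (F ik.1 θ₀)) (by fun_prop)
  have hXident (i : Fin I) (k : ℕ) : IdentDistrib (X i k) (X i 0) μ μ :=
    IdentDistrib.comp ⟨(hTlaw i k).aemeasurable, (hTlaw i 0).aemeasurable,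
      (hTlaw i k).map_eq.trans (hTlaw i 0).map_eq.symm⟩
      (OneShot.measurable_stdIndicator (τ i) (F i θ₀))
  have hX0 (i : Fin I) : μ[X i 0] = 0 :=
    ((hTlaw i 0).integral_comp
      (OneShot.measurable_stdIndicator (τ i) (F i θ₀)).aestronglyMeasurable).trans
      (OneShot.integral_stdIndicator _ rfl)
  have hX1 (i : Fin I) : μ[X i 0 ^ 2] = 1 :=
    ((hTlaw i 0).integral_comp (f := fun y => OneShot.stdIndicator (τ i) (F i θ₀) y ^ 2)
      ((OneShot.measurable_stdIndicator (τ i) (F i θ₀)).pow_const 2).aestronglyMeasurable).trans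
      (OneShot.integral_stdIndicator_sq _ rfl (h01 i))
  have hXL (i : Fin I) : MemLp (X i 0) 2 μ := by
    have h := OneShot.memLp_stdIndicator (τ i) (F i θ₀) (P θ₀ (x i))
    rw [← (hTlaw i 0).map_eq] at h
    exact h.comp_of_map (hTlaw i 0).aemeasurable
  have hKi (i : Fin I) : Tendsto (fun n => K n i) atTop atTop := by
    have hKr : Tendsto (fun n => ((∑ j, K n j : ℕ) : ℝ)) atTop atTop :=
      tendsto_natCast_atTop_atTop.comp hK
    refine tendsto_natCast_atTop_iff.1 (((hKw i).pos_mul_atTop (hw i) hKr).congr' ?_)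
    filter_upwards [hKr.eventually_gt_atTop 0] with n hn
    rw [div_mul_cancel₀ _ hn.ne']
  have hGbound (i : Fin I) (n : ℕ) (r : ℝ) (hr : r > 0) :
      μ {ω | r ≤ |G i n ω|} ≤ ENNReal.ofReal (1 / r ^ 2) := by
    refine (measure_mono fun ω hω => ?_).trans (OneShot.measure_le_abs_inv_sqrt_mul_sum_le
      (hXindep.precomp (g := fun k => (i, k)) fun a b h => (Prod.mk.inj h).2)
      (hXident i) (hXL i) (hX0 i) (hX1 i) (K n i) hr)
    rw [Set.mem_ofPred_eq, hGX, abs_mul] at hω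
    -- The standard deviation `v i` is at most 1, so the Chebyshev bound for the standardized sum
    -- also serves for `G`.
    refine hω.trans (mul_le_of_le_one_left (abs_nonneg _) ?_)
    rw [abs_of_nonneg (Real.sqrt_nonneg _), Real.sqrt_le_one]
    nlinarith [(h01 i).1, (h01 i).2]
  have hclt := OneShot.tendstoInDistribution_sum_inv_sqrt_mul_sum_smul hXindep hXident hX0 hX1 hKi
    (fun i => v i • c i)
  have hcov := OneShot.inv_Jmat_mul_Kmat_mul_inv_Jmat (γ := γ) hw h01
  simp only [hcov]
  have hY (n : ℕ) : AEMeasurable (fun ω => √(∑ i, K n i : ℕ) • (θhat n ω - θ₀)) μ :=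
    ((hmeas n).sub_const θ₀).fun_const_smul _
  -- Slutsky: it remains to show that the estimator differs from its linear part by a term vanishing
  -- in probability.
  refine tendstoInDistribution_of_tendstoInMeasure_sub _ _ hclt
    (OneShot.tendstoInMeasure_zero_of_forall_norm_le hmin hGbound fun M η hη => ?_) hY
  filter_upwards [OneShot.eventually_norm_sqrt_smul_sub_le hγ hΘ hw hF01 hFdiff hident A
    (OneShot.toEuclideanCLM_inv_Jmat_sum hJ) K hK hKw M hη] with n hn ω hω hM
  have hest := not_not.1 hω
  -- By definition, `wdpd` is `divSum` at the weights `K_i / K` and the observed frequencies.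
  have h := hn _ hM (θhat n ω) hest.1 hest.2
  simp only [Pi.sub_apply]
  refine le_of_eq_of_le ?_ h
  congr 2
  refine Finset.sum_congr rfl fun i _ => ?_
  change _ = G i n ω • c i
  rw [hGX, smul_smul, mul_comm (v i)]
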